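/- A \emph{tournamenton} is a measurable function $W:[0,1]^2\to[0,1]$ such that $W(x,y)+W(y,x)=1$ for all $(x,y)\in[0,1]^2$; it is \emph{regular} if $\int_0^1 W(x,y)\,\mathrm{d}y=\frac12$ for almost every $x\in[0,1]$. We write $W\equiv 1/2$ if $W$ is equal to $1/2$ almost everywhere on $[0,1]^2$. For a finite digraph $H$, the homomorphism density of $H$ in $W$ is \[t(H,W)=\int_{[0,1]^{V(H)}}\prod_{vw\in E(H)}W(x_v,x_w)\,\mathrm{d}x_{V(H)}.\] For positive integers $a,b,c$, let $C[a,b,c]$ be the digraph whose vertex set consists of three disjoint parts $A,B,C$ of sizes $a,b,c$, respectively, and whose edges are all the pairs directed from $A$ to $B$, from $B$ to $C$, and from $C$ to $A$ (in particular, each part is independent). \textbf{Theorem.} Let $a,b,c$ be positive integers such that $a+b+c\ge 4$. Every regular tournamenton $W$ satisfies \[t(C[a,b,c],W)\ge 2^{-ab-ac-bc}.\] Moreover, equality holds if and only if $W\equiv 1/2$. -/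

import Mathlib

open MeasureTheory

/-- A tournamenton: a (Lebesgue-)measurable function `W : [0,1]² → [0,1]` such that
`W(x,y) + W(y,x) = 1` for all `x, y`. Measurability with respect to the completed (Lebesgue)
σ-algebra is expressed by `AEMeasurable`; every Borel function is in particular allowed. -/
structure Tournamenton where
  toFun : unitInterval → unitInterval → ℝ
  aemeasurable : AEMeasurable (fun p : unitInterval × unitInterval => toFun p.1 p.2) volume
  mem_Icc : ∀ x y, toFun x y ∈ Set.Icc (0 : ℝ) 1
  add_swap : ∀ x y, toFun x y + toFun y x = 1

namespace Tournamenton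

instance : CoeFun Tournamenton (fun _ => unitInterval → unitInterval → ℝ) := ⟨toFun⟩

/-- `W` is regular if `∫ W(x,y) dy = 1/2` for almost every `x`. -/
def IsRegular (W : Tournamenton) : Prop :=
  ∀ᵐ x : unitInterval, ∫ y : unitInterval, W x y = 1 / 2

/-- `W ≡ 1/2`: the tournamenton is equal to `1/2` almost everywhere on `[0,1]²`. -/
def IsConstHalf (W : Tournamenton) : Prop :=
  ∀ᵐ p : unitInterval × unitInterval, W p.1 p.2 = 1 / 2

end Tournamenton

open Classical in
/-- The homomorphism density of a finite digraph `H` in a tournamenton `W`: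
`t(H,W) = ∫ ∏_{vw ∈ E(H)} W(x_v, x_w) dx_{V(H)}` over `[0,1]^{V(H)}`. -/
noncomputable def homDensity {V : Type*} [Fintype V] (H : Digraph V) (W : Tournamenton) : ℝ :=
  ∫ x : V → unitInterval,
    ∏ e ∈ Finset.univ.filter (fun e : V × V => H.Adj e.1 e.2), W (x e.1) (x e.2)

/-- The digraph `C[a,b,c]`: the blow-up of the cyclically oriented triangle with independent parts
of sizes `a`, `b` and `c`; all edges go from the `a`-part to the `b`-part, from the `b`-part to the
`c`-part, and from the `c`-part to the `a`-part, and there are no other edges. -/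
def blowUpC3 (a b c : ℕ) : Digraph (Fin a ⊕ Fin b ⊕ Fin c) where
  Adj
    | .inl _, .inr (.inl _) => True
    | .inr (.inl _), .inr (.inr _) => True
    | .inr (.inr _), .inl _ => True
    | _, _ => False

/-! Pass to `m = 2W`, so that the claim becomes a density of at least 1. Let `g(y,z)` be the density
of walks of length two from `z` to `y`, and let `G = ∫∫ g ^ a`.

Fix the `a`-tuple `x`. What remains is a count of complete bipartite graphs with weights `u(y) = ∏
m(x_i,y)` and `v(z) = ∏ m(z,x_i)`. With total weights `U`, `V` and weighted edge density `T`, the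
weighted Sidorenko inequality (`pow_integral_le_completeBipartite`) bounds the inner integral `I`
from below. AM-GM and Bernoulli make this bound linear in `T`, `U * V` and one of `U`, `V`
(`linear_le_of_pow_le`), so it can be integrated over `x`.

Regularity gives `∫ U = ∫ V = 1` and `∫ U * V = G`. It also makes `g` symmetric almost everywhere,
so averaging over the swap of `y` and `z` replaces `m` by 1 and `∫ T = G` as well. Hence the density
is at least `1 + max b c * (G - 1)` (`le_cyclicDensity`).

Since `g` has mean 1, `G ≥ 1 + ∫∫ (g - 1) ^ 2` once `a ≥ 2`. Equality therefore forces `g = 1`: the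
columns of `m - 1` are almost all pairwise orthogonal, so `m = 1` almost everywhere (`ae_eq_one`).
The cyclic triangle itself is excluded because its density is the same in every regular
tournamenton. -/

/-! ### Bounded measurable functions on probability spaces -/

/-- A measurable real function that is bounded. -/
def BoundedMeasurable {α : Type*} [MeasurableSpace α] (f : α → ℝ) : Prop :=
  Measurable f ∧ ∃ C, ∀ x, |f x| ≤ C

namespace BoundedMeasurable

theorem const {α : Type*} [MeasurableSpace α] (c : ℝ) : BoundedMeasurable fun _ : α => c :=
  ⟨measurable_const, |c|, fun _ => le_rfl⟩

theorem add {α : Type*} [MeasurableSpace α] {f g : α → ℝ} (hf : BoundedMeasurable f)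
    (hg : BoundedMeasurable g) : BoundedMeasurable fun x => f x + g x := by
  obtain ⟨hf, C, hC⟩ := hf
  obtain ⟨hg, D, hD⟩ := hg
  exact ⟨hf.add hg, C + D, fun x => (abs_add_le _ _).trans (add_le_add (hC x) (hD x))⟩

theorem mul {α : Type*} [MeasurableSpace α] {f g : α → ℝ} (hf : BoundedMeasurable f)
    (hg : BoundedMeasurable g) : BoundedMeasurable fun x => f x * g x := by
  obtain ⟨hf, C, hC⟩ := hf
  obtain ⟨hg, D, hD⟩ := hg
  refine ⟨hf.mul hg, C * D, fun x => ?_⟩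
  rw [abs_mul]
  exact mul_le_mul (hC x) (hD x) (abs_nonneg _) ((abs_nonneg _).trans (hC x))

theorem sub {α : Type*} [MeasurableSpace α] {f g : α → ℝ} (hf : BoundedMeasurable f)
    (hg : BoundedMeasurable g) : BoundedMeasurable fun x => f x - g x := by
  simpa [sub_eq_add_neg] using hf.add ((const (-1)).mul hg)

theorem pow {α : Type*} [MeasurableSpace α] {f : α → ℝ} (hf : BoundedMeasurable f) (n : ℕ) :
    BoundedMeasurable fun x => f x ^ n := by
  induction n with
  | zero => simpa using const (α := α) 1
  | succ n ih => simpa [pow_succ] using ih.mul hf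

theorem prod {α ι : Type*} [MeasurableSpace α] {f : ι → α → ℝ} (s : Finset ι)
    (hf : ∀ i, BoundedMeasurable (f i)) : BoundedMeasurable fun x => ∏ i ∈ s, f i x := by
  classical
  induction s using Finset.induction_on with
  | empty => simpa using const (α := α) 1
  | insert i s hi ih => simpa [Finset.prod_insert hi] using (hf i).mul ih

theorem comp {α β : Type*} [MeasurableSpace α] [MeasurableSpace β] {f : β → ℝ} {g : α → β}
    (hf : BoundedMeasurable f) (hg : Measurable g) : BoundedMeasurable fun x => f (g x) := by
  obtain ⟨hf, C, hC⟩ := hf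
  exact ⟨hf.comp hg, C, fun x => hC _⟩

theorem comp₂ {α β γ : Type*} [MeasurableSpace α] [MeasurableSpace β] [MeasurableSpace γ]
    {f : β → γ → ℝ} {g : α → β} {h : α → γ} (hf : BoundedMeasurable fun p : β × γ => f p.1 p.2)
    (hg : Measurable g) (hh : Measurable h) : BoundedMeasurable fun x => f (g x) (h x) :=
  hf.comp (hg.prodMk hh)

theorem integrable {α : Type*} [MeasureSpace α] [IsProbabilityMeasure (volume : Measure α)]
    {f : α → ℝ} (hf : BoundedMeasurable f) : Integrable f := by
  obtain ⟨hf, C, hC⟩ := hf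
  exact Integrable.of_bound hf.aestronglyMeasurable C (Filter.Eventually.of_forall hC)

theorem integral {α β : Type*} [MeasurableSpace α] [MeasureSpace β]
    [IsProbabilityMeasure (volume : Measure β)] {f : α → β → ℝ}
    (hf : BoundedMeasurable fun p : α × β => f p.1 p.2) :
    BoundedMeasurable fun x => ∫ y, f x y := by
  obtain ⟨hf, C, hC⟩ := hf
  refine ⟨(StronglyMeasurable.integral_prod_right (f := f) hf.stronglyMeasurable).measurable, C,
    fun x => ?_⟩
  simpa using norm_integral_le_of_norm_le_const (μ := (volume : Measure β)) (f := f x) (C := C)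
    (Filter.Eventually.of_forall fun y => hC (x, y))

theorem integral_swap {α β : Type*} [MeasureSpace α] [MeasureSpace β]
    [IsProbabilityMeasure (volume : Measure α)] [IsProbabilityMeasure (volume : Measure β)]
    {f : α → β → ℝ} (hf : BoundedMeasurable fun p : α × β => f p.1 p.2) :
    ∫ x, ∫ y, f x y = ∫ y, ∫ x, f x y :=
  integral_integral_swap hf.integrable

end BoundedMeasurable

/-! ### Power means and the weighted Sidorenko inequality -/

/-- The tangent line inequality for the convex function `x ↦ x ^ n` on `[0, ∞)`. -/
theorem pow_add_mul_sub_le_pow {x p : ℝ} (hx : 0 ≤ x) (hp : 0 < p) (n : ℕ) :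
    p ^ n + n * p ^ n * (x / p - 1) ≤ x ^ n := by
  have h := one_add_mul_sub_le_pow (a := x / p) (by linarith [div_nonneg hx hp.le]) n
  calc p ^ n + n * p ^ n * (x / p - 1) = p ^ n * (1 + n * (x / p - 1)) := by ring
    _ ≤ p ^ n * (x / p) ^ n := mul_le_mul_of_nonneg_left h (by positivity)
    _ = x ^ n := by rw [← mul_pow, mul_div_cancel₀ _ hp.ne']

/-- The power mean inequality with respect to an unnormalised weight. -/
theorem integral_mul_pow_le {α : Type*} [MeasureSpace α]
    [IsProbabilityMeasure (volume : Measure α)] {u f : α → ℝ} (hu : BoundedMeasurable u)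
    (hf : BoundedMeasurable f) (hu0 : ∀ x, 0 ≤ u x) (hf0 : ∀ x, 0 ≤ f x) {n : ℕ} (hn : 1 ≤ n) :
    (∫ x, u x * f x) ^ n ≤ (∫ x, u x) ^ (n - 1) * ∫ x, u x * f x ^ n := by
  have hm0 : 0 ≤ ∫ x, u x * f x := integral_nonneg fun x => mul_nonneg (hu0 x) (hf0 x)
  have hU0 : 0 ≤ ∫ x, u x := integral_nonneg hu0
  have hI0 : 0 ≤ ∫ x, u x * f x ^ n :=
    integral_nonneg fun x => mul_nonneg (hu0 x) (pow_nonneg (hf0 x) n)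
  rcases hm0.eq_or_lt with hm | hm
  · rw [← hm, zero_pow (by omega)]
    positivity
  have hU : 0 < ∫ x, u x := by
    refine hU0.lt_of_ne fun h => hm.ne ?_
    have h1 := (integral_eq_zero_iff_of_nonneg hu0 hu.integrable).1 h.symm
    rw [eq_comm]
    refine integral_eq_zero_of_ae ?_
    filter_upwards [h1] with x hx
    simp [hx]
  set U := ∫ x, u x
  set M := ∫ x, u x * f x
  have hp : 0 < M / U := div_pos hm hU
  -- The tangent is taken at the weighted mean `M / U`, so its linear term integrates to zero.
  have key : (M / U) ^ n * U ≤ ∫ x, u x * f x ^ n := by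
    have h1 : ∫ x, ((M / U) ^ n * u x + n * (M / U) ^ n * (u x * f x * (M / U)⁻¹ - u x))
        ≤ ∫ x, u x * f x ^ n := by
      refine integral_mono (BoundedMeasurable.integrable ?_) (hu.mul (hf.pow n)).integrable
        fun x => ?_
      · exact ((BoundedMeasurable.const _).mul hu).add ((BoundedMeasurable.const _).mul
          (((hu.mul hf).mul (BoundedMeasurable.const _)).sub hu))
      · have := mul_le_mul_of_nonneg_left (pow_add_mul_sub_le_pow (hf0 x) hp n) (hu0 x)
        refine le_trans (le_of_eq ?_) this
        simp only [div_eq_mul_inv]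
        ring
    have e1 : ∫ x, (u x * f x * (M / U)⁻¹ - u x) = 0 := by
      rw [integral_sub ((hu.mul hf).mul (BoundedMeasurable.const _)).integrable hu.integrable,
        integral_mul_const]
      change M * (M / U)⁻¹ - U = 0
      field_simp
      simp
    rw [integral_add ((BoundedMeasurable.const _).mul hu).integrable
      ((BoundedMeasurable.const _).mul
          (((hu.mul hf).mul (BoundedMeasurable.const _)).sub hu)).integrable,
      integral_const_mul, integral_const_mul, e1, mul_zero, add_zero] at h1
    exact h1
  calc M ^ n = U ^ (n - 1) * ((M / U) ^ n * U) := by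
        obtain ⟨k, rfl⟩ : ∃ k, n = k + 1 := ⟨n - 1, by omega⟩
        rw [div_pow, Nat.add_sub_cancel]
        field_simp
        ring
    _ ≤ _ := mul_le_mul_of_nonneg_left key (by positivity)

/-- The weighted Sidorenko inequality for complete bipartite graphs. -/
theorem pow_integral_le_completeBipartite {α β : Type*} [MeasureSpace α] [MeasureSpace β]
    [IsProbabilityMeasure (volume : Measure α)] [IsProbabilityMeasure (volume : Measure β)]
    {u : α → ℝ} {v : β → ℝ} {w : α → β → ℝ} (hu : BoundedMeasurable u) (hv : BoundedMeasurable v)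
    (hw : BoundedMeasurable fun p : α × β => w p.1 p.2) (hu0 : ∀ x, 0 ≤ u x) (hv0 : ∀ x, 0 ≤ v x)
    (hw0 : ∀ x y, 0 ≤ w x y) {b c : ℕ} (hb : 1 ≤ b) (hc : 1 ≤ c) :
    (∫ y, u y * ∫ z, v z * w y z) ^ (b * c) ≤
      (∫ y, u y) ^ (b * (c - 1)) * (∫ z, v z) ^ (c * (b - 1)) *
        ∫ z : Fin c → β, (∏ k, v (z k)) * ∫ y : Fin b → α, ∏ j, (u (y j) * ∏ k, w (y j) (z k)) := by
  have hv' : BoundedMeasurable fun z : Fin c → β => ∏ k, v (z k) :=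
    BoundedMeasurable.prod _ fun k => hv.comp (measurable_pi_apply k)
  have hW : BoundedMeasurable fun p : (Fin c → β) × α => u p.2 * ∏ k, w p.2 (p.1 k) :=
    (hu.comp measurable_snd).mul (BoundedMeasurable.prod _ fun k =>
      hw.comp₂ measurable_snd ((measurable_pi_apply k).comp measurable_fst))
  have hH := BoundedMeasurable.integral (f := fun (z : Fin c → β) y => u y * ∏ k, w y (z k)) hW
  have hQ := BoundedMeasurable.integral (f := fun (y : α) z => v z * w y z)
    ((hv.comp measurable_snd).mul hw)
  have hQ0 : ∀ y, 0 ≤ ∫ z, v z * w y z := fun y =>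
    integral_nonneg fun z => mul_nonneg (hv0 z) (hw0 y z)
  -- Two power means: exponent `c` in `y` with weight `u`, then exponent `b` in the tuple `z` with
  -- weight `∏ v`. They are linked by expanding the `c`-th power as an integral over `c`-tuples and
  -- swapping the integrals.
  have step1 := integral_mul_pow_le hu hQ hu0 hQ0 hc
  have step2 := integral_mul_pow_le hv' hH (fun z => Finset.prod_nonneg fun k _ => hv0 _)
    (fun z => integral_nonneg fun y => mul_nonneg (hu0 y) (Finset.prod_nonneg fun k _ => hw0 _ _))
    hb
  have e1 : ∫ z : Fin c → β, ∏ k, v (z k) = (∫ z, v z) ^ c := by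
    rw [integral_fintype_prod_volume_eq_pow, Fintype.card_fin]
  have e2 : ∫ z : Fin c → β, (∏ k, v (z k)) * ∫ y, u y * ∏ k, w y (z k) =
      ∫ y, u y * (∫ z, v z * w y z) ^ c := by
    simp_rw [← integral_const_mul]
    rw [BoundedMeasurable.integral_swap
      (f := fun (z : Fin c → β) y => (∏ k, v (z k)) * (u y * ∏ k, w y (z k)))
      ((hv'.comp measurable_fst).mul hW)]
    congr 1 with y
    rw [← Fintype.card_fin c, ← integral_fintype_prod_volume_eq_pow (fun z => v z * w y z),
      Fintype.card_fin, ← integral_const_mul]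
    congr 1 with z
    rw [Finset.prod_mul_distrib]
    ring
  have e3 : ∀ z : Fin c → β, ∫ y : Fin b → α, ∏ j, (u (y j) * ∏ k, w (y j) (z k)) =
      (∫ y, u y * ∏ k, w y (z k)) ^ b := fun z => by
    rw [integral_fintype_prod_volume_eq_pow (fun y => u y * ∏ k, w y (z k)), Fintype.card_fin]
  rw [e1, e2, ← pow_mul] at step2
  simp_rw [e3]
  have hU0 : 0 ≤ ∫ y, u y := integral_nonneg hu0
  calc (∫ y, u y * ∫ z, v z * w y z) ^ (b * c)
      = ((∫ y, u y * ∫ z, v z * w y z) ^ c) ^ b := by rw [← pow_mul, mul_comm]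
    _ ≤ ((∫ y, u y) ^ (c - 1) * ∫ y, u y * (∫ z, v z * w y z) ^ c) ^ b :=
        pow_le_pow_left₀ (pow_nonneg (integral_nonneg fun y => mul_nonneg (hu0 y) (hQ0 y)) _)
          step1 _
    _ = (∫ y, u y) ^ (b * (c - 1)) * (∫ y, u y * (∫ z, v z * w y z) ^ c) ^ b := by
        rw [mul_pow, ← pow_mul, mul_comm b]
    _ ≤ _ := by
        rw [mul_assoc]
        exact mul_le_mul_of_nonneg_left step2 (by positivity)

/-! ### Linearising the Sidorenko bound -/

/-- A form of the arithmetic-geometric mean inequality for `c` terms, `c - b` of which are equal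
to `U` and `b - 1` of which are equal to `1`. -/
theorem mul_le_add_of_mul_pow_eq {A U X : ℝ} {b c : ℕ} (hA : 0 ≤ A) (hU : 0 ≤ U) (hX : 0 ≤ X)
    (hb : 1 ≤ b) (hbc : b ≤ c) (h : A * U ^ (c - b) = X ^ c) :
    c * X ≤ A + (c - b) * U + (b - 1) := by
  have hc : (0 : ℝ) < c := by exact_mod_cast (by omega : 0 < c)
  have hbc' : (b : ℝ) ≤ c := by exact_mod_cast hbc
  have hb' : (1 : ℝ) ≤ b := by exact_mod_cast hb
  have amgm := Real.geom_mean_le_arith_mean3_weighted (w₁ := 1 / c) (w₂ := (c - b) / c)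
    (w₃ := (b - 1) / c) (by positivity) (div_nonneg (by linarith) hc.le)
    (div_nonneg (by linarith) hc.le) hA hU zero_le_one (by field_simp; ring)
  have hroot : A ^ (1 / c : ℝ) * U ^ ((c - b) / c : ℝ) = X := by
    refine (pow_left_inj₀ (by positivity) hX (by omega : c ≠ 0)).1 ?_
    rw [← h, mul_pow, ← Real.rpow_mul_natCast hA, ← Real.rpow_mul_natCast hU,
      div_mul_cancel₀ _ hc.ne', div_mul_cancel₀ _ hc.ne', Real.rpow_one, ← Nat.cast_sub hbc,
      Real.rpow_natCast]
  rw [hroot, Real.one_rpow, mul_one] at amgm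
  calc c * X ≤ c * (1 / c * A + (c - b) / c * U + (b - 1) / c * 1) :=
        mul_le_mul_of_nonneg_left amgm hc.le
    _ = _ := by field_simp

/-- A lower bound, linear in `T`, `U * V` and `U`, for a quantity `I` that satisfies the conclusion
of the weighted Sidorenko inequality. -/
theorem linear_le_of_pow_le {U V T I : ℝ} {b c : ℕ} (hU : 0 ≤ U) (hV : 0 ≤ V) (hT : 0 ≤ T)
    (hI : 0 ≤ I) (hTUV : T ≤ 2 * (U * V)) (hb : 1 ≤ b) (hbc : b ≤ c)
    (h : T ^ (b * c) ≤ U ^ (b * (c - 1)) * V ^ (c * (b - 1)) * I) :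
    c * (U * V) + b * c * (T - U * V) - (c - b) * U - (b - 1) ≤ I := by
  have hbc' : (b : ℝ) ≤ c := by exact_mod_cast hbc
  have hb' : (1 : ℝ) ≤ b := by exact_mod_cast hb
  rcases (mul_nonneg hU hV).eq_or_lt with h0 | h0
  -- If `U * V = 0`, the ratio `r` below is meaningless, but `hTUV` forces `T = 0` and the left side
  -- is nonpositive.
  · have : T = 0 := by linarith
    rw [this, ← h0]
    nlinarith
  have hU' : 0 < U := pos_of_mul_pos_left h0 hV
  have hV' : 0 < V := pos_of_mul_pos_right h0 hU
  set r := T / (U * V) with hr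
  have hr0 : 0 ≤ r := by positivity
  have hTr : T = r * (U * V) := by rw [hr]; field_simp
  have hA : r ^ (b * c) * U ^ b * V ^ c ≤ I := by
    have e : T ^ (b * c) =
        U ^ (b * (c - 1)) * V ^ (c * (b - 1)) * (r ^ (b * c) * U ^ b * V ^ c) := by
      have e1 : b * c = b * (c - 1) + b := by
        obtain ⟨k, rfl⟩ : ∃ k, c = k + 1 := ⟨c - 1, by omega⟩
        simp; ring
      have e2 : b * c = c * (b - 1) + c := by
        obtain ⟨k, rfl⟩ : ∃ k, b = k + 1 := ⟨b - 1, by omega⟩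
        simp; ring
      have f1 : U ^ (b * c) = U ^ (b * (c - 1)) * U ^ b := by rw [← pow_add, ← e1]
      have f2 : V ^ (b * c) = V ^ (c * (b - 1)) * V ^ c := by rw [← pow_add, ← e2]
      rw [hTr, mul_pow, mul_pow, f1, f2]
      ring
    rw [e] at h
    exact le_of_mul_le_mul_left h (by positivity)
  -- The `c - b` copies of `U` complete `U ^ b` to `U ^ c`, so the geometric mean is exactly `r ^ b
  -- * (U * V)`.
  have key := mul_le_add_of_mul_pow_eq (A := r ^ (b * c) * U ^ b * V ^ c) (U := U)
    (X := r ^ b * (U * V)) (by positivity) hU (by positivity) hb hbc (by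
      have : U ^ c = U ^ b * U ^ (c - b) := by rw [← pow_add]; congr 1; omega
      rw [mul_pow, mul_pow, ← pow_mul, this]
      ring)
  have bern : 1 + b * (r - 1) ≤ r ^ b := one_add_mul_sub_le_pow (by linarith) b
  have hc0 : (0 : ℝ) ≤ c := by positivity
  have := mul_le_mul_of_nonneg_left (mul_le_mul_of_nonneg_right bern h0.le) hc0
  have e : c * (U * V) + b * c * (T - U * V) = c * ((1 + b * (r - 1)) * (U * V)) := by
    rw [hTr]; ring
  linarith

/-! ### Regular kernels and walks of length two -/

/-- Twice a regular tournamenton on a probability space. -/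
structure IsRegularKernel {Ω : Type*} [MeasureSpace Ω] (m : Ω → Ω → ℝ) : Prop where
  measurable : Measurable fun p : Ω × Ω => m p.1 p.2
  nonneg : ∀ x y, 0 ≤ m x y
  add_swap : ∀ x y, m x y + m y x = 2
  regular : ∀ᵐ x, ∫ y, m x y = 1

/-- The density of the walks of length two from `z` to `y`. -/
noncomputable def pathDensity {Ω : Type*} [MeasureSpace Ω] (m : Ω → Ω → ℝ) (y z : Ω) : ℝ :=
  ∫ x, m x y * m z x

/-- The homomorphism density of the blow-up of the cyclic triangle in a kernel. -/
noncomputable def cyclicDensity {Ω : Type*} [MeasureSpace Ω] (m : Ω → Ω → ℝ) (a b c : ℕ) : ℝ :=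
  ∫ x : Fin a → Ω, ∫ y : Fin b → Ω, ∫ z : Fin c → Ω,
    (∏ i, ∏ j, m (x i) (y j)) * (∏ j, ∏ k, m (y j) (z k)) * ∏ k, ∏ i, m (z k) (x i)

namespace IsRegularKernel

variable {Ω : Type*} [MeasureSpace Ω] {m : Ω → Ω → ℝ}

theorem le_two (hm : IsRegularKernel m) (x y : Ω) : m x y ≤ 2 := by
  linarith [hm.add_swap x y, hm.nonneg y x]

theorem boundedMeasurable (hm : IsRegularKernel m) :
    BoundedMeasurable fun p : Ω × Ω => m p.1 p.2 :=
  ⟨hm.measurable, 2, fun p => by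
    rw [abs_of_nonneg (hm.nonneg _ _)]
    exact hm.le_two _ _⟩

theorem boundedMeasurable_comp (hm : IsRegularKernel m) {α : Type*} [MeasurableSpace α]
    {f g : α → Ω} (hf : Measurable f) (hg : Measurable g) :
    BoundedMeasurable fun x => m (f x) (g x) :=
  hm.boundedMeasurable.comp₂ hf hg

theorem pathDensity_nonneg (hm : IsRegularKernel m) (y z : Ω) : 0 ≤ pathDensity m y z :=
  integral_nonneg fun _ => mul_nonneg (hm.nonneg _ _) (hm.nonneg _ _)

variable [IsProbabilityMeasure (volume : Measure Ω)]

theorem regular_left (hm : IsRegularKernel m) : ∀ᵐ y, ∫ x, m x y = 1 := by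
  filter_upwards [hm.regular] with y hy
  have : ∀ x, m x y = 2 - m y x := fun x => by linarith [hm.add_swap x y]
  simp_rw [this]
  rw [integral_sub (integrable_const _)
    (hm.boundedMeasurable.comp measurable_prodMk_left).integrable, hy]
  simp
  norm_num

theorem boundedMeasurable_pathDensity (hm : IsRegularKernel m) :
    BoundedMeasurable fun p : Ω × Ω => pathDensity m p.1 p.2 :=
  BoundedMeasurable.integral (f := fun (p : Ω × Ω) x => m x p.1 * m p.2 x)
    ((hm.boundedMeasurable_comp (by fun_prop) (by fun_prop)).mul
      (hm.boundedMeasurable_comp (by fun_prop) (by fun_prop)))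

/-- Reversing both edges of the walk by `add_swap` leaves, besides the product, only terms whose
integrals cancel: `4 - 2 - 2 = 0`. -/
theorem pathDensity_comm (hm : IsRegularKernel m) {y z : Ω} (hy : ∫ x, m x y = 1)
    (hz : ∫ x, m z x = 1) : pathDensity m z y = pathDensity m y z := by
  have h : ∀ x, m x z * m y x = 4 - 2 * m x y - 2 * m z x + m x y * m z x := fun x => by
    rw [show m x z = 2 - m z x by linarith [hm.add_swap x z],
      show m y x = 2 - m x y by linarith [hm.add_swap x y]]
    ring
  have h1 : BoundedMeasurable fun x => m x y :=
    hm.boundedMeasurable_comp measurable_id measurable_const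
  have h2 : BoundedMeasurable fun x => m z x :=
    hm.boundedMeasurable_comp measurable_const measurable_id
  have h0 := BoundedMeasurable.const (α := Ω)
  unfold pathDensity
  simp_rw [h]
  rw [integral_add (((h0 4).sub ((h0 2).mul h1)).sub ((h0 2).mul h2)).integrable
      (h1.mul h2).integrable,
    integral_sub ((h0 4).sub ((h0 2).mul h1)).integrable ((h0 2).mul h2).integrable,
    integral_sub (h0 4).integrable ((h0 2).mul h1).integrable, integral_const_mul,
    integral_const_mul, hy, hz]
  simp
  norm_num

theorem integral_pathDensity (hm : IsRegularKernel m) : ∫ y, ∫ z, pathDensity m y z = 1 := by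
  unfold pathDensity
  have h : ∀ y, ∫ z, ∫ x, m x y * m z x = ∫ x, m x y := fun y => by
    rw [BoundedMeasurable.integral_swap (f := fun z x => m x y * m z x)
      ((hm.boundedMeasurable_comp (by fun_prop) (by fun_prop)).mul
      (hm.boundedMeasurable_comp (by fun_prop) (by fun_prop)))]
    refine integral_congr_ae ?_
    filter_upwards [hm.regular_left] with x hx
    rw [integral_const_mul, hx, mul_one]
  simp_rw [h]
  rw [integral_congr_ae (g := fun _ => (1 : ℝ)) hm.regular_left]
  simp

/-- As `pathDensity` is symmetric almost everywhere, exchanging `y` and `z` replaces the factor `m`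
by `2 - m`, so `m` may be replaced by its average 1. -/
theorem integral_mul_pathDensity_pow (hm : IsRegularKernel m) (a : ℕ) :
    ∫ y, ∫ z, m y z * pathDensity m y z ^ a = ∫ y, ∫ z, pathDensity m y z ^ a := by
  have hg : BoundedMeasurable fun p : Ω × Ω => pathDensity m p.1 p.2 ^ a :=
    hm.boundedMeasurable_pathDensity.pow a
  have hmg := hm.boundedMeasurable.mul hg
  have h1 : ∫ y, ∫ z, m y z * pathDensity m y z ^ a =
      ∫ y, ∫ z, (2 - m y z) * pathDensity m y z ^ a := by
    rw [BoundedMeasurable.integral_swap (f := fun y z => m y z * pathDensity m y z ^ a) hmg]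
    refine integral_congr_ae ?_
    filter_upwards [hm.regular] with y hy
    refine integral_congr_ae ?_
    filter_upwards [hm.regular_left] with z hz
    rw [hm.pathDensity_comm hz hy, show m z y = 2 - m y z by linarith [hm.add_swap y z]]
  have h2 : ∫ y, ∫ z, (2 - m y z) * pathDensity m y z ^ a =
      2 * (∫ y, ∫ z, pathDensity m y z ^ a) - ∫ y, ∫ z, m y z * pathDensity m y z ^ a := by
    rw [← integral_const_mul, ← integral_sub
      (((BoundedMeasurable.const 2).mul hg.integral).integrable) hmg.integral.integrable]
    congr 1 with y
    rw [← integral_const_mul, ← integral_sub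
      ((BoundedMeasurable.const 2).mul (hg.comp measurable_prodMk_left)).integrable
      (hmg.comp measurable_prodMk_left).integrable]
    congr 1 with z
    ring
  linarith

theorem integral_prod_left (hm : IsRegularKernel m) (a : ℕ) :
    ∫ x : Fin a → Ω, ∫ y, ∏ i, m (x i) y = 1 := by
  rw [BoundedMeasurable.integral_swap (f := fun (x : Fin a → Ω) y => ∏ i, m (x i) y)
    (BoundedMeasurable.prod _ fun i => hm.boundedMeasurable_comp (by fun_prop) (by fun_prop)),
    integral_congr_ae (g := fun _ => (1 : ℝ))]
  · simp
  · filter_upwards [hm.regular_left] with y hy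
    rw [integral_fintype_prod_volume_eq_pow (fun x => m x y), hy, one_pow]

theorem integral_prod_right (hm : IsRegularKernel m) (a : ℕ) :
    ∫ x : Fin a → Ω, ∫ z, ∏ i, m z (x i) = 1 := by
  rw [BoundedMeasurable.integral_swap (f := fun (x : Fin a → Ω) z => ∏ i, m z (x i))
    (BoundedMeasurable.prod _ fun i => hm.boundedMeasurable_comp (by fun_prop) (by fun_prop)),
    integral_congr_ae (g := fun _ => (1 : ℝ))]
  · simp
  · filter_upwards [hm.regular] with y hy
    rw [integral_fintype_prod_volume_eq_pow (fun x => m y x), hy, one_pow]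

/-- For fixed `y` and `z`, the integral over `x` factors over the coordinates, each contributing one
`pathDensity m y z`. -/
theorem integral_prod_mul_prod (hm : IsRegularKernel m) {w : Ω → Ω → ℝ}
    (hw : BoundedMeasurable fun p : Ω × Ω => w p.1 p.2) (a : ℕ) :
    ∫ x : Fin a → Ω, ∫ y, (∏ i, m (x i) y) * ∫ z, (∏ i, m z (x i)) * w y z =
      ∫ y, ∫ z, w y z * pathDensity m y z ^ a := by
  have hl : BoundedMeasurable fun p : ((Fin a → Ω) × Ω) × Ω => ∏ i, m (p.1.1 i) p.1.2 :=
    BoundedMeasurable.prod _ fun i => hm.boundedMeasurable_comp (by fun_prop) (by fun_prop)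
  have hr : BoundedMeasurable fun p : ((Fin a → Ω) × Ω) × Ω => ∏ i, m p.2 (p.1.1 i) :=
    BoundedMeasurable.prod _ fun i => hm.boundedMeasurable_comp (by fun_prop) (by fun_prop)
  have hF := hl.mul (hr.mul (hw.comp₂ (measurable_fst.snd : Measurable
    fun p : ((Fin a → Ω) × Ω) × Ω => p.1.2) measurable_snd))
  simp_rw [← integral_const_mul]
  rw [BoundedMeasurable.integral_swap (f := fun (x : Fin a → Ω) y =>
    ∫ z, (∏ i, m (x i) y) * ((∏ i, m z (x i)) * w y z))
    (BoundedMeasurable.integral (f := fun (p : (Fin a → Ω) × Ω) z =>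
      (∏ i, m (p.1 i) p.2) * ((∏ i, m z (p.1 i)) * w p.2 z)) hF)]
  congr 1 with y
  rw [BoundedMeasurable.integral_swap (f := fun (x : Fin a → Ω) z =>
    (∏ i, m (x i) y) * ((∏ i, m z (x i)) * w y z))
    (hF.comp (g := fun p : (Fin a → Ω) × Ω => ((p.1, y), p.2)) (by fun_prop))]
  congr 1 with z
  have := integral_fintype_prod_volume_eq_pow (ι := Fin a) (fun x => m x y * m z x)
  rw [Fintype.card_fin] at this
  unfold pathDensity
  rw [← this, ← integral_const_mul]
  congr 1 with x
  rw [Finset.prod_mul_distrib]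
  ring

theorem integral_mul_integral (hm : IsRegularKernel m) (a : ℕ) :
    ∫ x : Fin a → Ω, (∫ y, ∏ i, m (x i) y) * (∫ z, ∏ i, m z (x i)) =
      ∫ y, ∫ z, pathDensity m y z ^ a := by
  have := hm.integral_prod_mul_prod (w := fun _ _ => 1) (BoundedMeasurable.const 1) a
  simpa [integral_mul_const] using this

/-! ### The lower bound for the cyclic density -/

theorem le_cyclicDensity (hm : IsRegularKernel m) (a : ℕ) {b c : ℕ} (hb : 1 ≤ b) (hc : 1 ≤ c) :
    1 + (max b c : ℕ) * ((∫ y, ∫ z, pathDensity m y z ^ a) - 1) ≤ cyclicDensity m a b c := by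
  have hu : BoundedMeasurable fun p : (Fin a → Ω) × Ω => ∏ i, m (p.1 i) p.2 :=
    BoundedMeasurable.prod _ fun i => hm.boundedMeasurable_comp (by fun_prop) (by fun_prop)
  have hv : BoundedMeasurable fun p : (Fin a → Ω) × Ω => ∏ i, m p.2 (p.1 i) :=
    BoundedMeasurable.prod _ fun i => hm.boundedMeasurable_comp (by fun_prop) (by fun_prop)
  have hvw : BoundedMeasurable fun p : ((Fin a → Ω) × Ω) × Ω =>
      (∏ i, m p.2 (p.1.1 i)) * m p.1.2 p.2 :=
    (BoundedMeasurable.prod _ fun i => hm.boundedMeasurable_comp (by fun_prop) (by fun_prop)).mul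
      (hm.boundedMeasurable_comp (by fun_prop) (by fun_prop))
  set U : (Fin a → Ω) → ℝ := fun x => ∫ y, ∏ i, m (x i) y with hUdef
  set V : (Fin a → Ω) → ℝ := fun x => ∫ z, ∏ i, m z (x i) with hVdef
  set T : (Fin a → Ω) → ℝ := fun x => ∫ y, (∏ i, m (x i) y) * ∫ z, (∏ i, m z (x i)) * m y z
    with hTdef
  set I : (Fin a → Ω) → ℝ := fun x => ∫ y : Fin b → Ω, ∫ z : Fin c → Ω,
    (∏ i, ∏ j, m (x i) (y j)) * (∏ j, ∏ k, m (y j) (z k)) * ∏ k, ∏ i, m (z k) (x i) with hIdef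
  have hU : BoundedMeasurable U := BoundedMeasurable.integral hu
  have hV : BoundedMeasurable V := BoundedMeasurable.integral hv
  have hT : BoundedMeasurable T := BoundedMeasurable.integral
    (f := fun (x : Fin a → Ω) y => (∏ i, m (x i) y) * ∫ z, (∏ i, m z (x i)) * m y z)
    (hu.mul (BoundedMeasurable.integral (f := fun (p : (Fin a → Ω) × Ω) z =>
      (∏ i, m z (p.1 i)) * m p.2 z) hvw))
  have hF : BoundedMeasurable fun p : ((Fin a → Ω) × (Fin b → Ω)) × (Fin c → Ω) =>
      (∏ i, ∏ j, m (p.1.1 i) (p.1.2 j)) * (∏ j, ∏ k, m (p.1.2 j) (p.2 k)) *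
        ∏ k, ∏ i, m (p.2 k) (p.1.1 i) := by
    refine BoundedMeasurable.mul (BoundedMeasurable.mul ?_ ?_) ?_ <;>
    exact BoundedMeasurable.prod _ fun i => BoundedMeasurable.prod _ fun j =>
      hm.boundedMeasurable_comp (by fun_prop) (by fun_prop)
  have hI : BoundedMeasurable I := BoundedMeasurable.integral
    (f := fun (x : Fin a → Ω) (y : Fin b → Ω) => ∫ z : Fin c → Ω,
    (∏ i, ∏ j, m (x i) (y j)) * (∏ j, ∏ k, m (y j) (z k)) * ∏ k, ∏ i, m (z k) (x i))
    (BoundedMeasurable.integral (f := fun (p : (Fin a → Ω) × (Fin b → Ω)) (z : Fin c → Ω) =>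
      (∏ i, ∏ j, m (p.1 i) (p.2 j)) * (∏ j, ∏ k, m (p.2 j) (z k)) *
        ∏ k, ∏ i, m (z k) (p.1 i)) hF)
  have hu0 : ∀ (x : Fin a → Ω) y, 0 ≤ ∏ i, m (x i) y := fun x y =>
    Finset.prod_nonneg fun i _ => hm.nonneg _ _
  have hv0 : ∀ (x : Fin a → Ω) y, 0 ≤ ∏ i, m y (x i) := fun x y =>
    Finset.prod_nonneg fun i _ => hm.nonneg _ _
  have hU0 : ∀ x, 0 ≤ U x := fun x => integral_nonneg (hu0 x)
  have hV0 : ∀ x, 0 ≤ V x := fun x => integral_nonneg (hv0 x)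
  have hT0 : ∀ x, 0 ≤ T x := fun x => integral_nonneg fun y => mul_nonneg (hu0 x y)
    (integral_nonneg fun z => mul_nonneg (hv0 x z) (hm.nonneg _ _))
  have hI0 : ∀ x, 0 ≤ I x := fun x => integral_nonneg fun y => integral_nonneg fun z => by
    refine mul_nonneg (mul_nonneg ?_ ?_) ?_ <;>
    exact Finset.prod_nonneg fun i _ => Finset.prod_nonneg fun j _ => hm.nonneg _ _
  have hTUV : ∀ x, T x ≤ 2 * (U x * V x) := fun x => by
    have e : 2 * (U x * V x) = ∫ y, (∏ i, m (x i) y) * (2 * V x) := by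
      rw [integral_mul_const]; ring
    rw [e]
    have hvwx := BoundedMeasurable.integral (f := fun y z => (∏ i, m z (x i)) * m y z)
      (hvw.comp (g := fun p : Ω × Ω => ((x, p.1), p.2)) (by fun_prop))
    refine integral_mono ((hu.comp measurable_prodMk_left).mul hvwx).integrable
      ((hu.comp measurable_prodMk_left).mul (BoundedMeasurable.const _)).integrable fun y => ?_
    refine mul_le_mul_of_nonneg_left ?_ (hu0 x y)
    rw [hVdef, ← integral_const_mul]
    refine integral_mono (hvw.comp (g := fun z : Ω => ((x, y), z)) (by fun_prop)).integrable
      ((BoundedMeasurable.const _).mul (hv.comp measurable_prodMk_left)).integrable fun z => ?_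
    simp only
    rw [mul_comm]
    exact mul_le_mul_of_nonneg_right (hm.le_two _ _) (hv0 x z)
  have hsid : ∀ x, T x ^ (b * c) ≤ U x ^ (b * (c - 1)) * V x ^ (c * (b - 1)) * I x := fun x => by
    have h := pow_integral_le_completeBipartite (hu.comp (measurable_prodMk_left (x := x)))
      (hv.comp (measurable_prodMk_left (x := x))) hm.boundedMeasurable (hu0 x) (hv0 x) hm.nonneg
      hb hc
    refine h.trans_eq ?_
    congr 1
    simp only [hIdef]
    rw [BoundedMeasurable.integral_swap (f := fun (y : Fin b → Ω) (z : Fin c → Ω) =>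
      (∏ i, ∏ j, m (x i) (y j)) * (∏ j, ∏ k, m (y j) (z k)) * ∏ k, ∏ i, m (z k) (x i))
      (hF.comp (g := fun p : (Fin b → Ω) × (Fin c → Ω) => ((x, p.1), p.2)) (by fun_prop))]
    congr 1 with z
    rw [← integral_const_mul]
    congr 1 with y
    rw [Finset.prod_mul_distrib, Finset.prod_comm (f := fun i j => m (x i) (y j))]
    ring
  have hUV := hU.mul hV
  have eUV : ∫ x, U x * V x = ∫ y, ∫ z, pathDensity m y z ^ a := hm.integral_mul_integral a
  have eT : ∫ x, T x = ∫ y, ∫ z, pathDensity m y z ^ a :=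
    (hm.integral_prod_mul_prod hm.boundedMeasurable a).trans (hm.integral_mul_pathDensity_pow a)
  -- Here `r` and `s` are the smaller and the larger of `b` and `c`, and `X` is `U` or `V`
  -- accordingly. The term with factor `r * s` vanishes because `T` and `U * V` have equal
  -- integrals.
  have main : ∀ (r s : ℝ) (X : (Fin a → Ω) → ℝ), BoundedMeasurable X → ∫ x, X x = 1 →
      (∀ x, s * (U x * V x) + r * s * (T x - U x * V x) - (s - r) * X x - (r - 1) ≤ I x) →
      1 + s * ((∫ y, ∫ z, pathDensity m y z ^ a) - 1) ≤ cyclicDensity m a b c := by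
    intro r s X hX eX h
    have h0 := BoundedMeasurable.const (α := Fin a → Ω)
    have i1 := (h0 s).mul hUV
    have i2 := (h0 (r * s)).mul (hT.sub hUV)
    have i3 := (h0 (s - r)).mul hX
    have h1 := integral_mono (((i1.add i2).sub i3).sub (h0 (r - 1))).integrable hI.integrable h
    rw [integral_sub ((i1.add i2).sub i3).integrable (h0 (r - 1)).integrable,
      integral_sub (i1.add i2).integrable i3.integrable,
      integral_add i1.integrable i2.integrable, integral_const_mul, integral_const_mul,
      integral_const_mul, integral_sub hT.integrable hUV.integrable, eT, eUV, eX] at h1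
    simp only [integral_const, probReal_univ, one_smul] at h1
    change _ ≤ ∫ x, I x
    linarith
  rcases le_total b c with hbc | hbc
  · rw [max_eq_right hbc]
    exact main b c U hU (hm.integral_prod_left a) fun x =>
      linear_le_of_pow_le (hU0 x) (hV0 x) (hT0 x) (hI0 x) (hTUV x) hb hbc (hsid x)
  · rw [max_eq_left hbc]
    refine main c b V hV (hm.integral_prod_right a) fun x => ?_
    have := linear_le_of_pow_le (hV0 x) (hU0 x) (hT0 x) (hI0 x)
      (by rw [mul_comm (V x)]; exact hTUV x) hc hbc (by
        rw [mul_comm c b, mul_comm (V x ^ _)]; exact hsid x)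
    rwa [mul_comm (V x)] at this

end IsRegularKernel

/-! ### The case of equality -/

/-- Bernoulli's inequality with a quadratic remainder, which detects any deviation of `pathDensity`
from 1. Each induction step gains `(g - 1) ^ 2 * (n + g - 1)`. -/
theorem one_add_mul_add_sq_le_pow {g : ℝ} (hg : 0 ≤ g) {n : ℕ} (hn : 2 ≤ n) :
    1 + n * (g - 1) + (g - 1) ^ 2 ≤ g ^ n := by
  induction n, hn using Nat.le_induction with
  | base => exact le_of_eq (by push_cast; ring)
  | succ n hn ih =>
    have h := mul_le_mul_of_nonneg_right ih hg
    have : 0 ≤ (g - 1) ^ 2 * (n + g - 1) :=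
      mul_nonneg (sq_nonneg _) (by
        have : (2 : ℝ) ≤ n := by exact_mod_cast hn
        linarith)
    have e := pow_succ g n
    push_cast
    linarith

/-- Integrals over pairs of sets determine a bounded measurable function. -/
theorem ae_eq_one_of_setIntegral_prod {Ω : Type*} [MeasureSpace Ω]
    [IsProbabilityMeasure (volume : Measure Ω)] {m : Ω × Ω → ℝ} (hm : BoundedMeasurable m)
    (hm0 : ∀ p, 0 ≤ m p)
    (h : ∀ s t : Set Ω, MeasurableSet s → MeasurableSet t →
      ∫ p in s ×ˢ t, m p = volume.real s * volume.real t) : ∀ᵐ p, m p = 1 := by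
  have hmeas : Measurable fun p => ENNReal.ofReal (m p) := hm.1.ennreal_ofReal
  -- A measure that is multiplicative on rectangles is the product measure, so the densities `m` and
  -- 1 define the same measure.
  have key : (volume : Measure Ω).prod volume =
      (volume : Measure (Ω × Ω)).withDensity fun p => ENNReal.ofReal (m p) := by
    refine Measure.prod_eq fun s t hs ht => ?_
    rw [withDensity_apply _ (hs.prod ht),
      ← ofReal_integral_eq_lintegral_ofReal hm.integrable.integrableOn
        (Filter.Eventually.of_forall hm0), h s t hs ht, ENNReal.ofReal_mul measureReal_nonneg]
    simp [Measure.real]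
  have h1 : (volume : Measure (Ω × Ω)).withDensity 1 =
      (volume : Measure (Ω × Ω)).withDensity fun p => ENNReal.ofReal (m p) := by
    rw [withDensity_one]
    exact key
  have h2 := (withDensity_eq_iff (by fun_prop) hmeas.aemeasurable (by simp)).1 h1
  filter_upwards [h2] with p hp
  have := congrArg ENNReal.toReal hp
  simpa [ENNReal.toReal_ofReal (hm0 p)] using this.symm

namespace IsRegularKernel

variable {Ω : Type*} [MeasureSpace Ω] [IsProbabilityMeasure (volume : Measure Ω)] {m : Ω → Ω → ℝ}

/-- The linear term of the pointwise bound integrates to zero, since `pathDensity` has mean 1. -/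
theorem one_add_integral_sq_le (hm : IsRegularKernel m) {a : ℕ} (ha : 2 ≤ a) :
    1 + ∫ y, ∫ z, (pathDensity m y z - 1) ^ 2 ≤ ∫ y, ∫ z, pathDensity m y z ^ a := by
  have hg := hm.boundedMeasurable_pathDensity
  have h0 := BoundedMeasurable.const (α := Ω × Ω)
  have hs := (hg.sub (h0 1)).pow 2
  have i1 := (h0 1).add ((h0 a).mul (hg.sub (h0 1)))
  have h : ∫ p : Ω × Ω, (1 + a * (pathDensity m p.1 p.2 - 1) + (pathDensity m p.1 p.2 - 1) ^ 2) ≤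
      ∫ p : Ω × Ω, pathDensity m p.1 p.2 ^ a :=
    integral_mono (i1.add hs).integrable (hg.pow a).integrable fun p =>
      one_add_mul_add_sq_le_pow (hm.pathDensity_nonneg _ _) ha
  have e : ∫ p : Ω × Ω, pathDensity m p.1 p.2 = 1 :=
    (integral_prod _ hg.integrable).trans hm.integral_pathDensity
  rw [integral_add i1.integrable hs.integrable, integral_add (h0 1).integrable
    ((h0 a).mul (hg.sub (h0 1))).integrable, integral_const_mul,
    integral_sub hg.integrable (h0 1).integrable, e] at h
  have e1 := integral_prod _ hs.integrable
  have e2 := integral_prod _ (hg.pow a).integrable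
  rw [← Measure.volume_eq_prod] at e1 e2
  rw [e1, e2] at h
  simpa using h

theorem one_le_integral_pathDensity_pow (hm : IsRegularKernel m) {a : ℕ} (ha : 2 ≤ a) :
    1 ≤ ∫ y, ∫ z, pathDensity m y z ^ a := by
  have h : 0 ≤ ∫ y, ∫ z, (pathDensity m y z - 1) ^ 2 :=
    integral_nonneg fun y => integral_nonneg fun z => sq_nonneg _
  linarith [hm.one_add_integral_sq_le ha]

theorem pathDensity_ae_eq_one (hm : IsRegularKernel m) {a : ℕ} (ha : 2 ≤ a)
    (h : ∫ y, ∫ z, pathDensity m y z ^ a ≤ 1) :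
    ∀ᵐ p : Ω × Ω, pathDensity m p.1 p.2 = 1 := by
  have hs := (hm.boundedMeasurable_pathDensity.sub (BoundedMeasurable.const 1)).pow 2
  have h0 : 0 ≤ ∫ y, ∫ z, (pathDensity m y z - 1) ^ 2 :=
    integral_nonneg fun y => integral_nonneg fun z => sq_nonneg _
  have h1 : ∫ p : Ω × Ω, (pathDensity m p.1 p.2 - 1) ^ 2 = 0 :=
    (integral_prod _ hs.integrable).trans (by linarith [hm.one_add_integral_sq_le ha])
  have h2 := (integral_eq_zero_iff_of_nonneg (fun p => sq_nonneg _) hs.integrable).1 h1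
  filter_upwards [h2] with p hp
  have := pow_eq_zero_iff (two_ne_zero) |>.1 hp
  linarith

/-- If almost all pairs have the expected number of walks of length two, then the kernel is
constant. -/
theorem ae_eq_one (hm : IsRegularKernel m) (h : ∀ᵐ p : Ω × Ω, pathDensity m p.1 p.2 = 1) :
    ∀ᵐ p : Ω × Ω, m p.1 p.2 = 1 := by
  have h0 := BoundedMeasurable.const (α := Ω)
  -- Reversing the edge from `z` turns the walk density into the inner product of columns `y` and
  -- `z` of `m - 1`.
  have hcorr : ∀ᵐ y : Ω, ∀ᵐ z : Ω, ∫ x, (m x y - 1) * (m x z - 1) = 0 := by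
    filter_upwards [Measure.ae_ae_of_ae_prod h, hm.regular_left] with y hy hy'
    filter_upwards [hy, hm.regular_left] with z hz hz'
    have h1 : BoundedMeasurable fun x => m x y :=
      hm.boundedMeasurable.comp measurable_prodMk_right
    have h2 : BoundedMeasurable fun x => m x z :=
      hm.boundedMeasurable.comp measurable_prodMk_right
    have h3 : BoundedMeasurable fun x => m x y * m z x :=
      h1.mul (hm.boundedMeasurable.comp measurable_prodMk_left)
    have e : ∀ x, (m x y - 1) * (m x z - 1) = m x y - m x z + (1 - m x y * m z x) := fun x => by
      rw [show m z x = 2 - m x z by linarith [hm.add_swap z x]]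
      ring
    unfold pathDensity at hz
    simp_rw [e]
    rw [integral_add (h1.sub h2).integrable ((h0 1).sub h3).integrable,
      integral_sub h1.integrable h2.integrable, integral_sub (h0 1).integrable h3.integrable,
      hy', hz', hz]
    simp
  have hrow : ∀ s : Set Ω, MeasurableSet s → ∀ᵐ x, ∫ y, s.indicator 1 y * (m x y - 1) = 0 := by
    intro s hs
    have hi : BoundedMeasurable fun y : Ω => s.indicator (1 : Ω → ℝ) y :=
      ⟨measurable_one.indicator hs, 1, fun y => by
        by_cases hy : y ∈ s <;> simp [hy]⟩
    have hF : BoundedMeasurable fun p : Ω × Ω => s.indicator 1 p.2 * (m p.1 p.2 - 1) :=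
      (hi.comp measurable_snd).mul (hm.boundedMeasurable.sub (BoundedMeasurable.const 1))
    have hG := hF.integral (f := fun x y => s.indicator 1 y * (m x y - 1))
    have hFF : BoundedMeasurable fun p : (Ω × Ω) × Ω =>
        (s.indicator 1 p.1.2 * (m p.1.1 p.1.2 - 1)) * (s.indicator 1 p.2 * (m p.1.1 p.2 - 1)) :=
      (hF.comp (g := fun p : (Ω × Ω) × Ω => (p.1.1, p.1.2)) (by fun_prop)).mul
        (hF.comp (g := fun p : (Ω × Ω) × Ω => (p.1.1, p.2)) (by fun_prop))
    -- The square expands into the integral over `s ×ˢ s` of the inner products of columns, which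
    -- vanish almost everywhere.
    have hsq : ∫ x, (∫ y, s.indicator 1 y * (m x y - 1)) ^ 2 = 0 := by
      have e : ∀ x, (∫ y, s.indicator 1 y * (m x y - 1)) ^ 2 =
          ∫ y, ∫ z, (s.indicator 1 y * (m x y - 1)) * (s.indicator 1 z * (m x z - 1)) :=
        fun x => by
          simp_rw [integral_const_mul, integral_mul_const]
          ring
      simp_rw [e]
      rw [BoundedMeasurable.integral_swap (f := fun x y => ∫ z, (s.indicator 1 y * (m x y - 1)) *
        (s.indicator 1 z * (m x z - 1))) (BoundedMeasurable.integral (f := fun (p : Ω × Ω) z =>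
          (s.indicator 1 p.2 * (m p.1 p.2 - 1)) * (s.indicator 1 z * (m p.1 z - 1))) hFF)]
      refine integral_eq_zero_of_ae ?_
      filter_upwards [hcorr] with y hy
      rw [BoundedMeasurable.integral_swap (f := fun x z => (s.indicator 1 y * (m x y - 1)) *
        (s.indicator 1 z * (m x z - 1)))
        (hFF.comp (g := fun p : Ω × Ω => ((p.1, y), p.2)) (by fun_prop))]
      refine integral_eq_zero_of_ae ?_
      filter_upwards [hy] with z hz
      have e : ∀ x, (s.indicator 1 y * (m x y - 1)) * (s.indicator 1 z * (m x z - 1)) =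
          (s.indicator 1 y * s.indicator 1 z) * ((m x y - 1) * (m x z - 1)) := fun x => by ring
      simp_rw [e]
      rw [integral_const_mul, hz, mul_zero, Pi.zero_apply]
    have := (integral_eq_zero_iff_of_nonneg (fun x => sq_nonneg _) (hG.pow 2).integrable).1 hsq
    filter_upwards [this] with x hx
    exact pow_eq_zero_iff two_ne_zero |>.1 hx
  refine ae_eq_one_of_setIntegral_prod hm.boundedMeasurable (fun p => hm.nonneg _ _)
    fun s t hs ht => ?_
  rw [Measure.volume_eq_prod, setIntegral_prod _ (by
    rw [← Measure.volume_eq_prod]; exact hm.boundedMeasurable.integrable.integrableOn)]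
  have : ∀ᵐ x ∂volume.restrict s, ∫ y in t, m x y = volume.real t := by
    refine ae_restrict_of_ae ?_
    filter_upwards [hrow t ht] with x hx
    have e : ∀ y, t.indicator (1 : Ω → ℝ) y * (m x y - 1) = t.indicator (fun y => m x y - 1) y :=
      fun y => by by_cases hy : y ∈ t <;> simp [hy]
    have hx' : Integrable fun y => m x y :=
      (hm.boundedMeasurable.comp measurable_prodMk_left).integrable
    simp_rw [e] at hx
    rw [integral_indicator ht, integral_sub hx'.integrableOn (integrable_const _)] at hx
    simp at hx
    linarith
  rw [integral_congr_ae this]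
  simp

theorem cyclicDensity_rotate (hm : IsRegularKernel m) (a b c : ℕ) :
    cyclicDensity m a b c = cyclicDensity m b c a := by
  have hF : BoundedMeasurable fun p : ((Fin a → Ω) × (Fin b → Ω)) × (Fin c → Ω) =>
      (∏ i, ∏ j, m (p.1.1 i) (p.1.2 j)) * (∏ j, ∏ k, m (p.1.2 j) (p.2 k)) *
        ∏ k, ∏ i, m (p.2 k) (p.1.1 i) := by
    refine BoundedMeasurable.mul (BoundedMeasurable.mul ?_ ?_) ?_ <;>
    exact BoundedMeasurable.prod _ fun i => BoundedMeasurable.prod _ fun j =>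
      hm.boundedMeasurable_comp (by fun_prop) (by fun_prop)
  unfold cyclicDensity
  rw [BoundedMeasurable.integral_swap (f := fun (x : Fin a → Ω) (y : Fin b → Ω) =>
    ∫ z : Fin c → Ω,
      (∏ i, ∏ j, m (x i) (y j)) * (∏ j, ∏ k, m (y j) (z k)) * ∏ k, ∏ i, m (z k) (x i))
    (BoundedMeasurable.integral (f := fun (p : (Fin a → Ω) × (Fin b → Ω)) (z : Fin c → Ω) =>
      (∏ i, ∏ j, m (p.1 i) (p.2 j)) * (∏ j, ∏ k, m (p.2 j) (z k)) *
        ∏ k, ∏ i, m (z k) (p.1 i)) hF)]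
  congr 1 with y
  rw [BoundedMeasurable.integral_swap (f := fun (x : Fin a → Ω) (z : Fin c → Ω) =>
      (∏ i, ∏ j, m (x i) (y j)) * (∏ j, ∏ k, m (y j) (z k)) * ∏ k, ∏ i, m (z k) (x i))
    (hF.comp (g := fun p : (Fin a → Ω) × (Fin c → Ω) => ((p.1, y), p.2)) (by fun_prop))]
  congr 1 with z
  congr 1 with x
  ring

/-- The density bound for blow-ups of the cyclic triangle whose first part has at least two
vertices. -/
theorem one_le_cyclicDensity_aux (hm : IsRegularKernel m) {a b c : ℕ} (ha : 2 ≤ a) (hb : 1 ≤ b)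
    (hc : 1 ≤ c) : 1 ≤ cyclicDensity m a b c ∧
      (cyclicDensity m a b c = 1 → ∀ᵐ p : Ω × Ω, m p.1 p.2 = 1) := by
  have h := hm.le_cyclicDensity a hb hc
  have h1 := hm.one_le_integral_pathDensity_pow ha
  have h2 : (1 : ℝ) ≤ (max b c : ℕ) := by exact_mod_cast hb.trans (le_max_left b c)
  refine ⟨by nlinarith, fun heq => hm.ae_eq_one (hm.pathDensity_ae_eq_one ha ?_)⟩
  by_contra! hlt
  nlinarith

theorem one_le_cyclicDensity (hm : IsRegularKernel m) {a b c : ℕ} (ha : 1 ≤ a) (hb : 1 ≤ b)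
    (hc : 1 ≤ c) (habc : 4 ≤ a + b + c) : 1 ≤ cyclicDensity m a b c ∧
      (cyclicDensity m a b c = 1 → ∀ᵐ p : Ω × Ω, m p.1 p.2 = 1) := by
  rcases (by omega : 2 ≤ a ∨ 2 ≤ b ∨ 2 ≤ c) with h | h | h
  · exact hm.one_le_cyclicDensity_aux h hb hc
  · rw [hm.cyclicDensity_rotate]
    exact hm.one_le_cyclicDensity_aux h hc ha
  · rw [hm.cyclicDensity_rotate, hm.cyclicDensity_rotate]
    exact hm.one_le_cyclicDensity_aux h ha hb

end IsRegularKernel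

/-! ### From tournamentons to Borel kernels -/

/-- Evaluation at two distinct indices preserves the product measure. -/
theorem measurePreserving_eval_pair {ι Ω : Type*} [Fintype ι] [MeasureSpace Ω]
    [IsProbabilityMeasure (volume : Measure Ω)] {v w : ι} (h : v ≠ w) :
    MeasurePreserving (fun x : ι → Ω => (x v, x w)) := by
  have hi := ProbabilityTheory.iIndepFun_pi (ι := ι) (μ := fun _ => (volume : Measure Ω))
    (X := fun _ x => x) (fun _ => measurable_id.aemeasurable)
  have hp := (ProbabilityTheory.indepFun_iff_map_prod_eq_prod_map_map
    (measurable_pi_apply v).aemeasurable (measurable_pi_apply w).aemeasurable).1 (hi.indepFun h)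
  refine ⟨by fun_prop, ?_⟩
  have hv := (measurePreserving_eval (fun _ : ι => (volume : Measure Ω)) v).map_eq
  have hw := (measurePreserving_eval (fun _ : ι => (volume : Measure Ω)) w).map_eq
  exact hp.trans (congrArg₂ Measure.prod hv hw)

open Classical in
theorem prod_blowUpC3 {M : Type*} [CommMonoid M] (a b c : ℕ)
    (f : Fin a ⊕ Fin b ⊕ Fin c → Fin a ⊕ Fin b ⊕ Fin c → M) :
    ∏ e ∈ Finset.univ.filter (fun e : (Fin a ⊕ Fin b ⊕ Fin c) × (Fin a ⊕ Fin b ⊕ Fin c) =>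
      (blowUpC3 a b c).Adj e.1 e.2), f e.1 e.2 =
      (∏ i, ∏ j, f (.inl i) (.inr (.inl j))) * (∏ j, ∏ k, f (.inr (.inl j)) (.inr (.inr k))) *
        ∏ k, ∏ i, f (.inr (.inr k)) (.inl i) := by
  rw [Finset.prod_filter, Fintype.prod_prod_type]
  simp [Fintype.prod_sum_type, blowUpC3, mul_assoc]

theorem integral_sum_pi {a b c : ℕ} {Ω : Type*} [MeasureSpace Ω]
    [IsProbabilityMeasure (volume : Measure Ω)] {F : (Fin a → Ω) → (Fin b → Ω) → (Fin c → Ω) → ℝ}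
    (hF : BoundedMeasurable fun p : ((Fin a → Ω) × (Fin b → Ω)) × (Fin c → Ω) =>
      F p.1.1 p.1.2 p.2) :
    ∫ x : Fin a ⊕ Fin b ⊕ Fin c → Ω, F (fun i => x (.inl i)) (fun j => x (.inr (.inl j)))
      (fun k => x (.inr (.inr k))) = ∫ x, ∫ y, ∫ z, F x y z := by
  have h1 := (volume_measurePreserving_sumPiEquivProdPi
    (fun _ : Fin a ⊕ Fin b ⊕ Fin c => Ω)).integral_comp'
    (g := fun p => F p.1 (fun j => p.2 (.inl j)) (fun k => p.2 (.inr k)))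
  have hF' : BoundedMeasurable fun p : (Fin a → Ω) × (Fin b ⊕ Fin c → Ω) =>
      F p.1 (fun j => p.2 (.inl j)) (fun k => p.2 (.inr k)) :=
    hF.comp (g := fun p : (Fin a → Ω) × (Fin b ⊕ Fin c → Ω) =>
      ((p.1, fun j => p.2 (.inl j)), fun k => p.2 (.inr k))) (by fun_prop)
  refine h1.trans ((integral_prod _ hF'.integrable).trans ?_)
  congr 1 with x
  have h2 := (volume_measurePreserving_sumPiEquivProdPi
    (fun _ : Fin b ⊕ Fin c => Ω)).integral_comp' (g := fun p => F x p.1 p.2)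
  exact h2.trans (integral_prod _ (hF.comp (g := fun p : (Fin b → Ω) × (Fin c → Ω) =>
    ((x, p.1), p.2)) (by fun_prop)).integrable)

theorem homDensity_blowUpC3 (W : Tournamenton) {m : unitInterval → unitInterval → ℝ}
    (hm : BoundedMeasurable fun p : unitInterval × unitInterval => m p.1 p.2)
    (h : ∀ᵐ p : unitInterval × unitInterval, 2 * W p.1 p.2 = m p.1 p.2) (a b c : ℕ) :
    homDensity (blowUpC3 a b c) W =
      (2 : ℝ) ^ (-(a * b : ℤ) - a * c - b * c) * cyclicDensity m a b c := by
  -- The restriction `v ≠ w` is essential: almost everywhere equality on the square says nothing on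
  -- the diagonal. `blowUpC3` has no loops, so this suffices.
  have hpair : ∀ᵐ x : Fin a ⊕ Fin b ⊕ Fin c → unitInterval,
      ∀ v w, v ≠ w → W (x v) (x w) = 2⁻¹ * m (x v) (x w) := by
    rw [ae_all_iff]; intro v
    rw [ae_all_iff]; intro w
    by_cases hvw : v = w
    · exact Filter.Eventually.of_forall fun x hne => (hne hvw).elim
    · filter_upwards [(measurePreserving_eval_pair hvw).quasiMeasurePreserving.ae h] with x hx _
      rw [← hx]
      ring
  have hF : BoundedMeasurable fun p : ((Fin a → unitInterval) × (Fin b → unitInterval)) ×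
      (Fin c → unitInterval) =>
      (∏ i, ∏ j, m (p.1.1 i) (p.1.2 j)) * (∏ j, ∏ k, m (p.1.2 j) (p.2 k)) *
        ∏ k, ∏ i, m (p.2 k) (p.1.1 i) := by
    refine BoundedMeasurable.mul (BoundedMeasurable.mul ?_ ?_) ?_ <;>
    exact BoundedMeasurable.prod _ fun i => BoundedMeasurable.prod _ fun j =>
      hm.comp₂ (by fun_prop) (by fun_prop)
  have hpow : (2 : ℝ) ^ (-(a * b : ℤ) - a * c - b * c) =
      (2⁻¹ ^ b) ^ a * (2⁻¹ ^ c) ^ b * (2⁻¹ ^ a) ^ c := by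
    rw [← pow_mul, ← pow_mul, ← pow_mul, ← pow_add, ← pow_add, inv_pow, ← zpow_natCast,
      ← zpow_neg]
    congr 1
    push_cast
    ring
  unfold homDensity cyclicDensity
  rw [← integral_sum_pi (F := fun x y z => (∏ i, ∏ j, m (x i) (y j)) *
    (∏ j, ∏ k, m (y j) (z k)) * ∏ k, ∏ i, m (z k) (x i)) hF, ← integral_const_mul]
  refine integral_congr_ae ?_
  filter_upwards [hpair] with x hx
  refine (prod_blowUpC3 a b c fun v w => W (x v) (x w)).trans ?_
  rw [hpow]
  simp only [hx _ _ (Sum.inl_ne_inr), hx _ _ (Sum.inr_ne_inl),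
    fun j k => hx (.inr (.inl j)) (.inr (.inr k)) (by simp), Finset.prod_mul_distrib,
    Finset.prod_const, Finset.card_univ, Fintype.card_fin]
  ring

/-- Twice a regular tournamenton is almost everywhere equal to a Borel measurable regular
kernel. -/
theorem Tournamenton.exists_isRegularKernel (W : Tournamenton) (hW : W.IsRegular) :
    ∃ m : unitInterval → unitInterval → ℝ, IsRegularKernel m ∧
      ∀ᵐ p : unitInterval × unitInterval, 2 * W p.1 p.2 = m p.1 p.2 := by
  set V := W.aemeasurable.mk with hV
  have hVm : Measurable V := W.aemeasurable.measurable_mk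
  have hVW : ∀ᵐ p : unitInterval × unitInterval, W p.1 p.2 = V p := W.aemeasurable.ae_eq_mk
  have hVW' : ∀ᵐ p : unitInterval × unitInterval, W p.2 p.1 = V p.swap :=
    (Measure.measurePreserving_swap (μ := (volume : Measure unitInterval))
      (ν := (volume : Measure unitInterval))).quasiMeasurePreserving.ae hVW
  -- The difference `V (x, y) - V (y, x)` equals `2 * W x y - 1` almost everywhere. Antisymmetry and
  -- truncation to `[-1, 1]` make `add_swap` and `nonneg` hold at every point, not just almost
  -- everywhere.
  set m : unitInterval → unitInterval → ℝ :=
    fun x y => 1 + max (-1) (min 1 (V (x, y) - V (y, x))) with hmdef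
  have heq : ∀ᵐ p : unitInterval × unitInterval, 2 * W p.1 p.2 = m p.1 p.2 := by
    filter_upwards [hVW, hVW'] with p h1 h2
    have h3 := W.add_swap p.1 p.2
    have h4 := W.mem_Icc p.1 p.2
    have e : V (p.1, p.2) - V (p.2, p.1) = 2 * W p.1 p.2 - 1 := by
      change V p - V p.swap = _
      rw [← h1, ← h2]
      linarith
    rw [hmdef]
    simp only
    rw [e, min_eq_right (by linarith [h4.2]), max_eq_right (by linarith [h4.1])]
    ring
  refine ⟨m, ⟨?_, fun x y => ?_, fun x y => ?_, ?_⟩, heq⟩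
  · have : Measurable fun p : unitInterval × unitInterval => V (p.2, p.1) :=
      hVm.comp measurable_swap
    exact measurable_const.add (measurable_const.max (measurable_const.min (hVm.sub this)))
  · have := le_max_left (-1) (min 1 (V (x, y) - V (y, x)))
    simp only [hmdef]
    linarith
  · simp only [hmdef]
    have e : V (y, x) - V (x, y) = -(V (x, y) - V (y, x)) := by ring
    rw [e]
    generalize V (x, y) - V (y, x) = t
    rcases le_total t 1 with h1 | h1 <;> rcases le_total (-1) t with h2 | h2 <;>
      simp [max_def, min_def] <;> split_ifs <;> linarith
  · filter_upwards [Measure.ae_ae_of_ae_prod heq, hW] with x h1 h2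
    rw [← integral_congr_ae h1, integral_const_mul, h2]
    norm_num

theorem cyclicDensity_eq_one {m : unitInterval → unitInterval → ℝ} (a b c : ℕ)
    (h : ∀ x y, m x y = 1) : cyclicDensity m a b c = 1 := by
  simp [cyclicDensity, h]

theorem mainTheorem4 (a b c : ℕ) (ha : 1 ≤ a) (hb : 1 ≤ b) (hc : 1 ≤ c) (habc : 4 ≤ a + b + c)
    (W : Tournamenton) (hW : W.IsRegular) :
    homDensity (blowUpC3 a b c) W ≥ (2 : ℝ) ^ (-(a * b : ℤ) - a * c - b * c) ∧
      (homDensity (blowUpC3 a b c) W = (2 : ℝ) ^ (-(a * b : ℤ) - a * c - b * c) ↔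
        W.IsConstHalf) := by
  obtain ⟨m, hm, heq⟩ := W.exists_isRegularKernel hW
  have hpos : (0 : ℝ) < (2 : ℝ) ^ (-(a * b : ℤ) - a * c - b * c) := by positivity
  have hden := homDensity_blowUpC3 W hm.boundedMeasurable heq a b c
  obtain ⟨h1, h2⟩ := hm.one_le_cyclicDensity ha hb hc habc
  refine ⟨?_, fun h => ?_, fun h => ?_⟩
  · rw [hden]
    exact le_mul_of_one_le_right hpos.le h1
  · have hone : cyclicDensity m a b c = 1 := by
      rw [hden] at h
      exact mul_left_cancel₀ hpos.ne' (h.trans (mul_one _).symm)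
    filter_upwards [heq, h2 hone] with p hp hp'
    linarith
  -- The constant kernel also represents `2 * W` here, and its density is immediate.
  · rw [homDensity_blowUpC3 W (m := fun _ _ => 1) (BoundedMeasurable.const 1)
      (h.mono fun p hp => by rw [hp]; norm_num) a b c, cyclicDensity_eq_one a b c fun _ _ => rfl,
      mul_one]
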